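/- **Model.** A tile type consists of four glues (north, south, east, west) and a color; tiles are not rotated. A pattern $P$ of width $w$ and height $h$ assigns a color to every index $(i,j)$ (column $i$, row $j$, rows numbered upwards) with $1\le i\le w$, $1\le j\le h$. A rectilinear tile assembly system consists of a finite set $T$ of tile types in which distinct types have distinct (south, west) glue pairs, and an L-shaped seed exposing north glues at $(1,0),\dots,(w,0)$ and east glues at $(0,1),\dots,(0,h)$. A tile attaches at an empty index $(i,j)$ of the rectangle when its west glue equals the east glue present at $(i-1,j)$ and its south glue equals the north glue present at $(i,j-1)$. The system uniquely self-assembles $P$ if there is exactly one terminal assembly (an assembly grown from the seed to which no tile can attach) and it has the colors of $P$ on the whole rectangle. $T$ solves $P$ if it does so for some seed. **Colors.** Patterns and tile types use 29 colors: Black, White, el-Black, el-White, Carry Blue, RAB, RAW, UAB, UAW (Right- /Up-Arrow Black/White), $\mathrm{Black}_i,\mathrm{White}_i,\mathrm{G}_i$ $(1\le i\le4)$ and $\mathrm{P}_k$ $(1\le k\le 8)$. The nine *yellow* values are Black, $\mathrm P_1,\dots,\mathrm P_8$. **Proposition.** Suppose that translates of all of the following blocks (the sub-patterns LB1–LB118;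 of LB2–LB41 and LB47–LB118 only the listed cells are required, the other cells may have any color) appear in the pattern $P$. 1. (LB1) A block of width 7 and height 21 whose columns 2, 4, 6 are entirely el-Black, el-White, Carry Blue respectively, and whose columns 1, 3, 5, 7 are White in row 20 and Black in the other rows. 2. (LB2–LB5) Three cells $(1,2),(2,1),(2,2)$ with the colors (UAB, Black, Black); (UAB, Black, White); (UAW, White, Black); (UAW, White, White). 3. (LB6–LB23) For each $i\le 4$ and each yellow $y$: cells $(1,2),(2,2),(2,1)$ with the colors RAB, $\mathrm G_i$, $y$. (LB24–LB41) The same with RAW in place of RAB. 4. (LB42–LB46) For $(b,w)=(\text{Black},\text{White})$ and for $(b,w)=(\text{Black}_i,\text{White}_i)$, $1\le i\le 4$: a block of width 10 and height 5 with columns 2, 5, 7, 9 entirely Carry Blue, columns 1, 3, 4, 6 equal to $b,b,w,w,b$ and columns 8, 10 equal to $w,w,b,w,b$ (from row 1 to row 5). 5. (LB47–LB82) For each $i\le4$ and each yellow $y$: cells $(1,1),\dots,(6,1)$ of color $y$, cells $(1,2),\dots,(6,2)$ of color $\mathrm G_i$, and cell $(7,2)$ of color UAB. 6. (LB83–LB118)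 For each $i\le4$ and each yellow $y$: cells $(1,1),\dots,(4,1)$ of color $y$, cells $(1,2),\dots,(4,2)$ of color $\mathrm G_i$, and cell $(5,2)$ of color UAW. Then every tile type set $T$ that solves $P$ has at least 46 tile types. Moreover, if $|T|\le 46$, then $T$ contains at least 4 types of each of the colors Carry Blue, RAB, RAW, UAB, UAW, at least 2 types of each of the colors el-Black, el-White, and at least 1 type of each of the other 22 colors. -/

import Mathlib

namespace PATS

/-! ### Tiles, seeds and rectilinear tile assembly systems -/

/-- The 29 colors. `blackCopy i`, `whiteCopy i` are Black1 to Black4 and White1 to White4,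
`purple k` are P1 to P8 and `green i` are G1 to G4. The colors `rab`, `raw`, `uab`, `uaw` are
Right-Arrow Black, Right-Arrow White, Up-Arrow Black and Up-Arrow White. -/
inductive Color : Type
  | black | white | elBlack | elWhite | carryBlue | rab | raw | uab | uaw
  | blackCopy (i : Fin 4) | whiteCopy (i : Fin 4) | purple (k : Fin 8) | green (i : Fin 4)
  deriving DecidableEq

/-- A tile type: four glues and a color. -/
structure TileType (Glue : Type*) where
  north : Glue
  south : Glue
  east : Glue
  west : Glue
  color : Color

/-- An L-shaped seed, given by the glues that it exposes: `north i` is the north glue of the seed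
tile at `(i, 0)` and `east j` is the east glue of the seed tile at `(0, j)`. For a rectangle of
width `w` and height `h` only `1 ≤ i ≤ w` and `1 ≤ j ≤ h` matter. -/
structure Seed (Glue : Type*) where
  north : ℕ → Glue
  east : ℕ → Glue

/-- A rectangular color pattern: the cell in column `i` and row `j` has color `color i j`, where
`1 ≤ i ≤ width` and `1 ≤ j ≤ height`; other values of `color` are never used. -/
structure ColorPattern where
  width : ℕ
  height : ℕ
  color : ℕ → ℕ → Color

/-- The index `(i, j)` (column, row) lies in the rectangle of the pattern. -/
def ColorPattern.Mem (P : ColorPattern) (i j : ℕ) : Prop :=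
  1 ≤ i ∧ i ≤ P.width ∧ 1 ≤ j ∧ j ≤ P.height

/-- A (partial) assembly: which tile type, if any, has been placed at index `(i, j)`. -/
abbrev Assembly (Glue : Type*) := ℕ → ℕ → Option (TileType Glue)

variable {Glue : Type*}

/-- The east glue presented by index `(i, j)`, if there is a seed tile (`i = 0`) or a placed
tile there. -/
def Assembly.eastGlue (A : Assembly Glue) (σ : Seed Glue) (i j : ℕ) : Option Glue :=
  if i = 0 then some (σ.east j) else (A i j).map TileType.east

/-- The north glue presented by index `(i, j)`, if there is a seed tile (`j = 0`) or a placed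
tile there. -/
def Assembly.northGlue (A : Assembly Glue) (σ : Seed Glue) (i j : ℕ) : Option Glue :=
  if j = 0 then some (σ.north i) else (A i j).map TileType.north

/-- The assembly `A` with a tile of type `t` placed at `(i, j)`. -/
def Assembly.place (A : Assembly Glue) (i j : ℕ) (t : TileType Glue) : Assembly Glue :=
  fun i' j' => if i' = i ∧ j' = j then some t else A i' j'

/-- A tile of type `t ∈ T` can attach to `A` at the empty index `(i, j)` of the rectangle of `P`:
its west glue matches the east glue at `(i - 1, j)` and its south glue matches the north glue at
`(i, j - 1)`. -/
def CanAttach (T : Finset (TileType Glue)) (σ : Seed Glue) (P : ColorPattern)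
    (A : Assembly Glue) (i j : ℕ) (t : TileType Glue) : Prop :=
  P.Mem i j ∧ t ∈ T ∧ A i j = none ∧
    A.eastGlue σ (i - 1) j = some t.west ∧ A.northGlue σ i (j - 1) = some t.south

/-- The assemblies that grow from the seed by successive attachments. -/
inductive Producible (T : Finset (TileType Glue)) (σ : Seed Glue) (P : ColorPattern) :
    Assembly Glue → Prop
  | seed : Producible T σ P (fun _ _ => none)
  | attach {A : Assembly Glue} {i j : ℕ} {t : TileType Glue} :
      Producible T σ P A → CanAttach T σ P A i j t → Producible T σ P (A.place i j t)

/-- A terminal assembly: it grows from the seed and no more tile can attach. -/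
def IsTerminal (T : Finset (TileType Glue)) (σ : Seed Glue) (P : ColorPattern)
    (A : Assembly Glue) : Prop :=
  Producible T σ P A ∧ ∀ i j t, ¬ CanAttach T σ P A i j t

/-- The uniqueness requirement on a tile type set: distinct tile types have distinct
(south, west) glue pairs. -/
def Uniqueness (T : Finset (TileType Glue)) : Prop :=
  ∀ t ∈ T, ∀ t' ∈ T, t.south = t'.south → t.west = t'.west → t = t'

/-- The rectilinear tile assembly system `(T, σ)` uniquely self-assembles `P`: `T` satisfies
uniqueness, and there is exactly one terminal assembly, which fills the rectangle and has the
colors of `P`. -/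
def UniquelyAssembles (T : Finset (TileType Glue)) (σ : Seed Glue) (P : ColorPattern) : Prop :=
  Uniqueness T ∧
    ∃ A, IsTerminal T σ P A ∧ (∀ B, IsTerminal T σ P B → B = A) ∧
      ∀ i j, P.Mem i j → (A i j).map TileType.color = some (P.color i j)

/-- The tile type set `T` solves `P`: with some seed it uniquely self-assembles `P`. -/
def Solves (T : Finset (TileType Glue)) (P : ColorPattern) : Prop :=
  ∃ σ : Seed Glue, UniquelyAssembles T σ P

/-! ### The sub-patterns -/

/-- A block of prescribed cells: `F i j = some c` prescribes color `c` in column `i` and row `j`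
of the block; cells with `F i j = none` are not prescribed (any color is allowed). -/
abbrev Block := ℕ → ℕ → Option Color

/-- Some translate of the block appears in the pattern. -/
def Block.AppearsIn (F : Block) (P : ColorPattern) : Prop :=
  ∃ a b : ℕ, ∀ i j c, F i j = some c → P.Mem (a + i) (b + j) ∧ P.color (a + i) (b + j) = c

/-- `LB1`, width 7 and height 21. Columns 2, 4, 6 are el-Black, el-White and Carry Blue; in the
other columns row 20 is White and every other row is Black. -/
def lb1 : Block := fun i j =>
  if 1 ≤ i ∧ i ≤ 7 ∧ 1 ≤ j ∧ j ≤ 21 then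
    if i = 2 then some .elBlack
    else if i = 4 then some .elWhite
    else if i = 6 then some .carryBlue
    else if j = 20 then some .white
    else some .black
  else none

/-- `LB42` (for `b, w` Black and White) and its copies `LB43` to `LB46`, width 10 and height 5.
Columns 2, 5, 7, 9 are Carry Blue. From row 1 to row 5, columns 1, 3, 4, 6 read `b b w w b` and
columns 8, 10 read `w w b w b` (read upwards as binary numbers, 12 and 12 - 1 = 11). -/
def lb42 (b w : Color) : Block := fun i j =>
  if 1 ≤ i ∧ i ≤ 10 ∧ 1 ≤ j ∧ j ≤ 5 then
    if i = 2 ∨ i = 5 ∨ i = 7 ∨ i = 9 then some .carryBlue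
    else if i ≤ 6 then (if j = 3 ∨ j = 4 then some w else some b)
    else (if j = 3 ∨ j = 5 then some b else some w)
  else none

/-- The prescribed cells of `LB2` to `LB5`: in the upper row an Up-Arrow cell of color `ua` and to
its right a cell of color `out`; below the latter, a cell of color `below`. -/
def topCorner (ua below out : Color) : Block := fun i j =>
  if i = 1 ∧ j = 2 then some ua
  else if i = 2 ∧ j = 1 then some below
  else if i = 2 ∧ j = 2 then some out
  else none

/-- The prescribed cells of `LB6` to `LB41`: in the upper row a Right-Arrow cell of color `ra` and
to its right a cell of the Green color `g`; below the latter, a cell of the variable-Yellow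
color `y`. -/
def greenCorner (ra g y : Color) : Block := fun i j =>
  if i = 1 ∧ j = 2 then some ra
  else if i = 2 ∧ j = 2 then some g
  else if i = 2 ∧ j = 1 then some y
  else none

/-- The prescribed cells of `LB47` to `LB118`: `n` consecutive cells of the Green color `g`, each
above a cell of the variable-Yellow color `y`, followed on the right, in the row of the Green
cells, by an Up-Arrow cell of color `ua`. -/
def greenRun (n : ℕ) (g y ua : Color) : Block := fun i j =>
  if 1 ≤ i ∧ i ≤ n ∧ j = 1 then some y
  else if 1 ≤ i ∧ i ≤ n ∧ j = 2 then some g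
  else if i = n + 1 ∧ j = 2 then some ua
  else none

/-- The 9 values of variable-Yellow: Black and P1 to P8. -/
def IsYellow (y : Color) : Prop :=
  y = .black ∨ ∃ k, y = .purple k

/-- The sub-patterns `LB1` to `LB118` appear in `P` (of the sub-patterns `LB2` to `LB41` and `LB47`
to `LB118`, only the cells above are prescribed, so this asks for less than the appearance of
the complete sub-patterns). -/
structure ContainsLB (P : ColorPattern) : Prop where
  lb1 : lb1.AppearsIn P
  lb2 : (topCorner .uab .black .black).AppearsIn P
  lb3 : (topCorner .uab .black .white).AppearsIn P
  lb4 : (topCorner .uaw .white .black).AppearsIn P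
  lb5 : (topCorner .uaw .white .white).AppearsIn P
  lb6_to_lb23 : ∀ (i : Fin 4) (y : Color), IsYellow y →
    (greenCorner .rab (.green i) y).AppearsIn P
  lb24_to_lb41 : ∀ (i : Fin 4) (y : Color), IsYellow y →
    (greenCorner .raw (.green i) y).AppearsIn P
  lb42 : (lb42 .black .white).AppearsIn P
  lb43_to_lb46 : ∀ i : Fin 4, (PATS.lb42 (.blackCopy i) (.whiteCopy i)).AppearsIn P
  lb47_to_lb82 : ∀ (i : Fin 4) (y : Color), IsYellow y →
    (greenRun 6 (.green i) y .uab).AppearsIn P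
  lb83_to_lb118 : ∀ (i : Fin 4) (y : Color), IsYellow y →
    (greenRun 4 (.green i) y .uaw).AppearsIn P

/-- The number of tile types of each color in the intended set of 46 tile types. -/
def lowerBound : Color → ℕ
  | .elBlack => 2
  | .elWhite => 2
  | .carryBlue => 4
  | .rab => 4
  | .raw => 4
  | .uab => 4
  | .uaw => 4
  | _ => 1

end PATS

namespace PATS

variable {Glue : Type*} {T : Finset (TileType Glue)} {σ : Seed Glue} {P : ColorPattern}

/-! ### Placed tiles -/

/-! A terminal assembly with the colors of `P` turns every block of `P` into tiles of `T` with
matching glues (`exists_realizes`). Since (south, west) determines a type, too few types of one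
color force distinct colors to coincide or make many types of another color necessary. Assume
`T.card ≤ 46`. The 29 colors need one type each, which leaves 17 to spare. A single el-Black,
el-White or Carry Blue type would require 19 Black types, and 19 + 28 > 46. Fewer than four Carry
Blue types make every copied Black/White pair have at least three types. Right of a Right-Arrow tile
and above a yellow tile, glues determine the green color, so the product of the two counts is at
least 4. A count shows that some yellow has only one type; hence four types of each Right-Arrow.
Over that yellow, a green run longer than its number of types is periodic and passes the west glue
of some green tile on to the Up-Arrow, so a missing Up-Arrow type costs a long run of green types.
All these bounds are combined by linear arithmetic in `lowerBound_le_colorCount`; they leave no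
slack, as 22 · 1 + 2 · 2 + 5 · 4 = 46. -/

theorem Producible.glues {A : Assembly Glue} (hA : Producible T σ P A) :
    ∀ i j t, A i j = some t → t ∈ T ∧ A.eastGlue σ (i - 1) j = some t.west ∧
      A.northGlue σ i (j - 1) = some t.south := by
  induction hA with
  | seed => intro i j t h; simp at h
  | @attach A i₀ j₀ t₀ _ hatt ih =>
    obtain ⟨_, ht₀, hnone, heast, hnorth⟩ := hatt
    -- An attachment fills only an empty index, so glues already presented persist.
    have keep_east : ∀ i j g, A.eastGlue σ i j = some g →
        (A.place i₀ j₀ t₀).eastGlue σ i j = some g := by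
      intro i j g h
      by_cases hi : i = 0
      · simpa [Assembly.eastGlue, hi] using h
      · by_cases hij : i = i₀ ∧ j = j₀
        · obtain ⟨rfl, rfl⟩ := hij
          simp [Assembly.eastGlue, hi, hnone] at h
        · simpa [Assembly.eastGlue, hi, Assembly.place, hij] using h
    have keep_north : ∀ i j g, A.northGlue σ i j = some g →
        (A.place i₀ j₀ t₀).northGlue σ i j = some g := by
      intro i j g h
      by_cases hj : j = 0
      · simpa [Assembly.northGlue, hj] using h
      · by_cases hij : i = i₀ ∧ j = j₀
        · obtain ⟨rfl, rfl⟩ := hij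
          simp [Assembly.northGlue, hj, hnone] at h
        · simpa [Assembly.northGlue, hj, Assembly.place, hij] using h
    intro i j t h
    by_cases hij : i = i₀ ∧ j = j₀
    · obtain ⟨rfl, rfl⟩ := hij
      obtain rfl : t₀ = t := by simpa [Assembly.place] using h
      exact ⟨ht₀, keep_east _ _ _ heast, keep_north _ _ _ hnorth⟩
    · have h' : A i j = some t := by simpa [Assembly.place, hij] using h
      obtain ⟨h1, h2, h3⟩ := ih i j t h'
      exact ⟨h1, keep_east _ _ _ h2, keep_north _ _ _ h3⟩

/-- The tiles `s i j` of `T` fill the prescribed cells of the block `F` with the prescribed colors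
and matching glues. -/
structure Realizes (T : Finset (TileType Glue)) (F : Block) (s : ℕ → ℕ → TileType Glue) :
    Prop where
  mem : ∀ {i j c}, F i j = some c → s i j ∈ T.filter (fun t => t.color = c)
  horizontal : ∀ {i j c c'}, F i j = some c → F (i + 1) j = some c' →
    (s (i + 1) j).west = (s i j).east
  vertical : ∀ {i j c c'}, F i j = some c → F i (j + 1) = some c' →
    (s i (j + 1)).south = (s i j).north

theorem UniquelyAssembles.exists_realizes (h : UniquelyAssembles T σ P) {F : Block}
    (hF : F.AppearsIn P) : ∃ s, Realizes T F s := by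
  obtain ⟨-, A, ⟨hA, -⟩, -, hcol⟩ := h
  obtain ⟨a, b, hab⟩ := hF
  have hex : ∀ i j, ∃ t, ∀ c, F i j = some c → A (a + i) (b + j) = some t ∧ t.color = c := by
    intro i j
    cases hc : F i j with
    -- At a cell that is not prescribed any tile will do; the seed supplies a glue to build one.
    | none => exact ⟨⟨σ.north 0, σ.north 0, σ.north 0, σ.north 0, .black⟩, by simp⟩
    | some c =>
      obtain ⟨hm, hc'⟩ := hab i j c hc
      obtain ⟨t, ht, htc⟩ := Option.map_eq_some_iff.1 (hcol _ _ hm)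
      refine ⟨t, fun c'' h'' => ⟨ht, ?_⟩⟩
      rw [htc, hc']
      exact Option.some.inj h''
  choose s hs using hex
  refine ⟨s, ⟨?_, ?_, ?_⟩⟩
  · intro i j c hc
    obtain ⟨h1, h2⟩ := hs i j c hc
    exact Finset.mem_filter.2 ⟨(hA.glues _ _ _ h1).1, h2⟩
  · intro i j c c' hc hc'
    -- `1 ≤ a + i`, so the left neighbor is a placed tile and not the seed.
    have h0 := (hab i j c hc).1.1
    have h1 := (hs _ _ _ hc).1
    have h2 := (hA.glues _ _ _ (hs _ _ _ hc').1).2.1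
    rw [show a + (i + 1) - 1 = a + i by omega, Assembly.eastGlue, if_neg (by omega), h1] at h2
    exact (Option.some.inj h2).symm
  · intro i j c c' hc hc'
    have h0 := (hab i j c hc).1.2.2.1
    have h1 := (hs _ _ _ hc).1
    have h2 := (hA.glues _ _ _ (hs _ _ _ hc').1).2.2
    rw [show b + (j + 1) - 1 = b + j by omega, Assembly.northGlue, if_neg (by omega), h1] at h2
    exact (Option.some.inj h2).symm

/-! ### Counting tile types by color -/

/-- The number of tile types of color `c`. -/
def colorCount (T : Finset (TileType Glue)) (c : Color) : ℕ :=
  (T.filter (fun t => t.color = c)).card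

theorem colorCount_pos {F : Block} {s : ℕ → ℕ → TileType Glue} (hs : Realizes T F s)
    {i j : ℕ} {c : Color} (hc : F i j = some c) : 1 ≤ colorCount T c :=
  Finset.card_pos.2 ⟨_, hs.mem hc⟩

theorem Realizes.eq_of_colorCount_le_one {F F' : Block} {s s' : ℕ → ℕ → TileType Glue}
    {c : Color} (hs : Realizes T F s) (hs' : Realizes T F' s') (hc : colorCount T c ≤ 1)
    {i j i' j' : ℕ} (h : F i j = some c) (h' : F' i' j' = some c) : s i j = s' i' j' :=
  Finset.card_le_one.1 hc _ (hs.mem h) _ (hs'.mem h')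

/-- The colors form five families, of 9, 4, 4, 8 and 4 colors. -/
def colorEquiv : Fin 9 ⊕ Fin 4 ⊕ Fin 4 ⊕ Fin 8 ⊕ Fin 4 ≃ Color where
  toFun
    | .inl k => ![.black, .white, .elBlack, .elWhite, .carryBlue, .rab, .raw, .uab, .uaw] k
    | .inr (.inl i) => .blackCopy i
    | .inr (.inr (.inl i)) => .whiteCopy i
    | .inr (.inr (.inr (.inl k))) => .purple k
    | .inr (.inr (.inr (.inr i))) => .green i
  invFun
    | .black => .inl 0
    | .white => .inl 1
    | .elBlack => .inl 2
    | .elWhite => .inl 3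
    | .carryBlue => .inl 4
    | .rab => .inl 5
    | .raw => .inl 6
    | .uab => .inl 7
    | .uaw => .inl 8
    | .blackCopy i => .inr (.inl i)
    | .whiteCopy i => .inr (.inr (.inl i))
    | .purple k => .inr (.inr (.inr (.inl k)))
    | .green i => .inr (.inr (.inr (.inr i)))
  left_inv := by
    rintro (k | i | i | k | i)
    · fin_cases k <;> rfl
    all_goals rfl
  right_inv := by
    rintro (_ | _ | _ | _ | _ | _ | _ | _ | _ | i | i | k | i) <;> rfl

/-- The nine single counts and the four family sums become the variables of the later linear
arithmetic. -/
theorem card_eq_sum_colorCount (T : Finset (TileType Glue)) :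
    T.card = colorCount T .black + colorCount T .white + colorCount T .elBlack +
      colorCount T .elWhite + colorCount T .carryBlue + colorCount T .rab + colorCount T .raw +
      colorCount T .uab + colorCount T .uaw + ∑ i, colorCount T (.blackCopy i) +
      ∑ i, colorCount T (.whiteCopy i) + ∑ k, colorCount T (.purple k) +
      ∑ i, colorCount T (.green i) := by
  have h := Finset.card_eq_sum_card_fiberwise (s := T) (t := Finset.univ)
    (f := fun t => colorEquiv.symm t.color) (by simp)
  have h' : ∀ x, (T.filter (fun t => colorEquiv.symm t.color = x)).card =
      colorCount T (colorEquiv x) := by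
    intro x
    simp only [colorCount, Equiv.symm_apply_eq]
  rw [h]
  simp only [h', Fintype.sum_sum_type]
  simp [colorEquiv, Fin.sum_univ_succ]
  ring

/-! ### Sequences of tiles that are determined by their predecessors -/

/-- A repetition before `N` propagates step by step, so that `u N` equals an earlier term, where `p`
holds. -/
theorem injOn_of_deterministic {α : Type*} {u : ℕ → α} {p : α → Prop} {N : ℕ}
    (hdet : ∀ i < N, ∀ j < N, u i = u j → u (i + 1) = u (j + 1))
    (hp : ∀ i < N, p (u i)) (hN : ¬ p (u N)) : Set.InjOn u (Finset.range N) := by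
  have key : ∀ i j, i < j → j < N → u i ≠ u j := by
    intro i j hij hj heq
    have hk : ∀ k, j + k ≤ N → u (i + k) = u (j + k) := by
      intro k
      induction k with
      | zero => intro _; exact heq
      | succ k ih => intro hle; exact hdet (i + k) (by omega) (j + k) (by omega) (ih (by omega))
    have h := hk (N - j) (by omega)
    rw [show j + (N - j) = N by omega] at h
    exact hN (h ▸ hp _ (by omega))
  intro i hi j hj heq
  simp only [Finset.coe_range, Set.mem_Iio] at hi hj
  rcases lt_trichotomy i j with h | h | h
  · exact absurd heq (key i j h hj)
  · exact h
  · exact absurd heq.symm (key j i h hi)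

/-! ### The columns of `lb1` -/

/-- With a single type in column `i`, all west glues of column `i + 1` agree, so each tile there is
determined by the one below it. The 19 Black tiles below the White one in row 20 are then distinct.
-/
theorem nineteen_le_colorCount_black {s : ℕ → ℕ → TileType Glue} (hU : Uniqueness T)
    (hs : Realizes T lb1 s) {i : ℕ} {c : Color} (hc : colorCount T c ≤ 1)
    (hcol : ∀ j, 1 ≤ j → j ≤ 21 → lb1 i j = some c)
    (hnext : ∀ j, 1 ≤ j → j ≤ 21 →
      lb1 (i + 1) j = some (if j = 20 then .white else .black)) :
    19 ≤ colorCount T .black := by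
  have hinj := injOn_of_deterministic (u := fun j => s (i + 1) (j + 1))
    (p := fun t => t.color = .black) (N := 19) ?_ ?_ ?_
  · have h := Finset.card_le_card_of_injOn (s := Finset.range 19)
      (t := T.filter (fun t => t.color = .black)) _ ?_ hinj
    · simpa [colorCount] using h
    · intro j hj
      have hj : j < 19 := by simpa using hj
      have h := hs.mem (hnext (j + 1) (by omega) (by omega))
      rwa [if_neg (by omega)] at h
  · intro j hj k hk hjk
    have mem : ∀ j < 19, s (i + 1) (j + 1 + 1) ∈ T := fun j hj =>
      (Finset.mem_filter.1 (hs.mem (hnext (j + 1 + 1) (by omega) (by omega)))).1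
    refine hU _ (mem j hj) _ (mem k hk) ?_ ?_
    · rw [hs.vertical (hnext (j + 1) (by omega) (by omega)) (hnext _ (by omega) (by omega)),
        hs.vertical (hnext (k + 1) (by omega) (by omega)) (hnext _ (by omega) (by omega))]
      exact congrArg _ hjk
    · rw [hs.horizontal (hcol (j + 1 + 1) (by omega) (by omega)) (hnext _ (by omega) (by omega)),
        hs.horizontal (hcol (k + 1 + 1) (by omega) (by omega)) (hnext _ (by omega) (by omega)),
        hs.eq_of_colorCount_le_one hs hc (hcol (j + 1 + 1) (by omega) (by omega))
          (hcol (k + 1 + 1) (by omega) (by omega))]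
  · intro j hj
    have h := hs.mem (hnext (j + 1) (by omega) (by omega))
    rw [if_neg (by omega)] at h
    exact (Finset.mem_filter.1 h).2
  · have h := (Finset.mem_filter.1 (hs.mem (hnext 20 (by omega) (by omega)))).2
    simp only [if_true] at h
    simp [h]

/-! ### The blocks `lb42` -/

/-- If `b` and `w` have one type each, columns 3 and 4 show that both types pass their west glue
eastwards and have the same south glue; hence their west glues differ. In rows 2 to 5, column 7 lies
between the pairs `b w`, `w b`, `w w`, `b b`, so its four tiles have distinct (west, east) glues. -/
theorem four_le_colorCount_carryBlue {s : ℕ → ℕ → TileType Glue} (hU : Uniqueness T)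
    {b w : Color} (hbw : b ≠ w) (hs : Realizes T (lb42 b w) s)
    (hb : colorCount T b ≤ 1) (hw : colorCount T w ≤ 1) : 4 ≤ colorCount T .carryBlue := by
  have eqb : ∀ i j, lb42 b w i j = some b → s i j = s 3 1 := fun i j h =>
    hs.eq_of_colorCount_le_one hs hb h (by simp [lb42])
  have eqw : ∀ i j, lb42 b w i j = some w → s i j = s 3 3 := fun i j h =>
    hs.eq_of_colorCount_le_one hs hw h (by simp [lb42])
  have hbe : (s 3 1).west = (s 3 1).east := by
    have h := hs.horizontal (i := 3) (j := 1) (c := b) (c' := b) (by simp [lb42]) (by simp [lb42])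
    rwa [eqb (3 + 1) 1 (by simp [lb42])] at h
  have hwe : (s 3 3).west = (s 3 3).east := by
    have h := hs.horizontal (i := 3) (j := 3) (c := w) (c' := w) (by simp [lb42]) (by simp [lb42])
    rwa [eqw (3 + 1) 3 (by simp [lb42])] at h
  have hsouth : (s 3 1).south = (s 3 3).south := by
    have h1 := hs.vertical (i := 3) (j := 1) (c := b) (c' := b) (by simp [lb42]) (by simp [lb42])
    have h2 := hs.vertical (i := 3) (j := 2) (c := b) (c' := w) (by simp [lb42]) (by simp [lb42])
    rw [eqb 3 (1 + 1) (by simp [lb42])] at h1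
    rw [eqb 3 2 (by simp [lb42]), ← h1] at h2
    exact h2.symm
  have hne : (s 3 1).west ≠ (s 3 3).west := by
    intro h
    have h1 := Finset.mem_filter.1 (hs.mem (i := 3) (j := 1) (c := b) (by simp [lb42]))
    have h3 := Finset.mem_filter.1 (hs.mem (i := 3) (j := 3) (c := w) (by simp [lb42]))
    have heq := hU _ h1.1 _ h3.1 hsouth h
    exact hbw (by rw [← h1.2, ← h3.2, heq])
  have row : ∀ j c c', lb42 b w 6 j = some c → lb42 b w 7 j = some .carryBlue →
      lb42 b w 8 j = some c' →
      (s 7 j).west = (s 6 j).east ∧ (s 7 j).east = (s 8 j).west := fun j c c' h6 h7 h8 =>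
    ⟨hs.horizontal h6 h7, (hs.horizontal h7 h8).symm⟩
  have r2 := row 2 b w (by simp [lb42]) (by simp [lb42]) (by simp [lb42])
  have r3 := row 3 w b (by simp [lb42]) (by simp [lb42]) (by simp [lb42])
  have r4 := row 4 w w (by simp [lb42]) (by simp [lb42]) (by simp [lb42])
  have r5 := row 5 b b (by simp [lb42]) (by simp [lb42]) (by simp [lb42])
  rw [eqb 6 2 (by simp [lb42]), eqw 8 2 (by simp [lb42]), ← hbe] at r2
  rw [eqw 6 3 (by simp [lb42]), eqb 8 3 (by simp [lb42]), ← hwe] at r3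
  rw [eqw 6 4 (by simp [lb42]), eqw 8 4 (by simp [lb42]), ← hwe] at r4
  rw [eqb 6 5 (by simp [lb42]), eqb 8 5 (by simp [lb42]), ← hbe] at r5
  have h := Finset.card_le_card_of_injOn (s := (Finset.univ : Finset (Fin 4)))
    (t := T.filter (fun t => t.color = .carryBlue)) ![s 7 2, s 7 3, s 7 4, s 7 5] ?_ ?_
  · simpa [colorCount] using h
  · intro k _
    have m : ∀ j, lb42 b w 7 j = some .carryBlue →
      s 7 j ∈ T.filter (fun t => t.color = .carryBlue) := fun j hj => hs.mem hj
    fin_cases k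
    · exact m 2 (by simp [lb42])
    · exact m 3 (by simp [lb42])
    · exact m 4 (by simp [lb42])
    · exact m 5 (by simp [lb42])
  · intro k _ l _ hkl
    have hw' := congrArg TileType.west hkl
    have he' := congrArg TileType.east hkl
    rw [hbe, hwe] at hne
    clear hkl
    fin_cases k <;> fin_cases l <;>
      simp [r2, r3, r4, r5, hbe, hwe, hne, hne.symm] at hw' he' ⊢

/-! ### Arrow tiles next to green tiles -/

/-- If every green color has a tile of `T` above a yellow tile and to the right of a tile of
color `a`, then the pairs of such tiles are different. -/
theorem four_le_mul_colorCount (hU : Uniqueness T) {a y : Color}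
    {g l u : Fin 4 → TileType Glue} (hg : ∀ i, g i ∈ T.filter (fun t => t.color = .green i))
    (hl : ∀ i, l i ∈ T.filter (fun t => t.color = a))
    (hu : ∀ i, u i ∈ T.filter (fun t => t.color = y))
    (hwest : ∀ i j, l i = l j → (g i).west = (g j).west)
    (hsouth : ∀ i j, u i = u j → (g i).south = (g j).south) :
    4 ≤ colorCount T a * colorCount T y := by
  have h := Finset.card_le_card_of_injOn (s := (Finset.univ : Finset (Fin 4)))
    (t := T.filter (fun t => t.color = a) ×ˢ T.filter (fun t => t.color = y))
    (fun i => (l i, u i)) ?_ ?_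
  · simpa [colorCount, Finset.card_product] using h
  · intro i _
    exact Finset.mem_coe.2 (Finset.mem_product.2 ⟨hl i, hu i⟩)
  · intro i _ j _ hij
    obtain ⟨h1, h2⟩ := Prod.mk.inj hij
    have hi := Finset.mem_filter.1 (hg i)
    have hj := Finset.mem_filter.1 (hg j)
    have heq := hU _ hi.1 _ hj.1 (hsouth _ _ h2) (hwest _ _ h1)
    exact Color.green.inj (by rw [← hi.2, ← hj.2, heq])

theorem four_le_mul_of_greenCorner (hU : Uniqueness T) {ra y : Color}
    (h : ∀ i, ∃ s, Realizes T (greenCorner ra (.green i) y) s) :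
    4 ≤ colorCount T ra * colorCount T y := by
  choose s hs using h
  have c1 : ∀ i, greenCorner ra (.green i) y 1 2 = some ra := fun i => by simp [greenCorner]
  have c2 : ∀ i, greenCorner ra (.green i) y 2 2 = some (.green i) := fun i => by
    simp [greenCorner]
  have c3 : ∀ i, greenCorner ra (.green i) y 2 1 = some y := fun i => by simp [greenCorner]
  refine four_le_mul_colorCount hU (g := fun i => s i 2 2) (l := fun i => s i 1 2)
    (u := fun i => s i 2 1) (fun i => (hs i).mem (c2 i)) (fun i => (hs i).mem (c1 i))
    (fun i => (hs i).mem (c3 i)) ?_ ?_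
  · intro i j hij
    have hij : s i 1 2 = s j 1 2 := hij
    have h1 := (hs i).horizontal (c1 i) (c2 i)
    have h2 := (hs j).horizontal (c1 j) (c2 j)
    rw [hij] at h1
    exact h1.trans h2.symm
  · intro i j hij
    have hij : s i 2 1 = s j 2 1 := hij
    have h1 := (hs i).vertical (c3 i) (c2 i)
    have h2 := (hs j).vertical (c3 j) (c2 j)
    rw [hij] at h1
    exact h1.trans h2.symm

section GreenRun

variable {n k : ℕ} {g y ua : Color}

theorem greenRun_lower (h1 : 1 ≤ k) (hk : k ≤ n) : greenRun n g y ua k 1 = some y := by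
  simp [greenRun, h1, hk]

theorem greenRun_upper (h1 : 1 ≤ k) (hk : k ≤ n) : greenRun n g y ua k 2 = some g := by
  simp [greenRun, h1, hk]

theorem greenRun_last : greenRun n g y ua (n + 1) 2 = some ua := by
  simp [greenRun]

end GreenRun

/-- If all the green colors have only one tile type, then an Up-Arrow tile and a yellow tile
determine the green tile. -/
theorem four_le_mul_of_greenRun (hU : Uniqueness T) {n : ℕ} (hn : 2 ≤ n) {ua y : Color}
    (h : ∀ i, ∃ s, Realizes T (greenRun n (.green i) y ua) s)
    (hone : ∀ i, colorCount T (.green i) ≤ 1) :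
    4 ≤ colorCount T ua * colorCount T y := by
  choose s hs using h
  -- Two adjacent copies of the only green type give it equal east and west glues, so the Up-Arrow
  -- tile receives the west glue of the green type.
  have hwest : ∀ i, (s i 1 2).west = (s i (n + 1) 2).west := by
    intro i
    have h1 := (hs i).horizontal (greenRun_upper (le_refl 1) (by omega))
      (greenRun_upper (k := 1 + 1) (by omega) (by omega))
    have h2 := (hs i).horizontal (greenRun_upper (k := n) (by omega) (by omega)) greenRun_last
    rw [(hs i).eq_of_colorCount_le_one (hs i) (hone i)
      (greenRun_upper (k := 1 + 1) (by omega) (by omega))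
      (greenRun_upper (k := 1) (by omega) (by omega))] at h1
    rw [(hs i).eq_of_colorCount_le_one (hs i) (hone i)
      (greenRun_upper (k := n) (by omega) (by omega))
      (greenRun_upper (k := 1) (by omega) (by omega)), ← h1] at h2
    exact h2.symm
  have hsouth : ∀ i, (s i 1 2).south = (s i 1 1).north := fun i =>
    (hs i).vertical (greenRun_lower (le_refl 1) (by omega))
      (greenRun_upper (le_refl 1) (by omega))
  refine four_le_mul_colorCount hU (g := fun i => s i 1 2) (l := fun i => s i (n + 1) 2)
    (u := fun i => s i 1 1) (fun i => (hs i).mem (greenRun_upper (by omega) (by omega)))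
    (fun i => (hs i).mem greenRun_last)
    (fun i => (hs i).mem (greenRun_lower (by omega) (by omega))) ?_ ?_
  · intro i j hij
    have hij : s i (n + 1) 2 = s j (n + 1) 2 := hij
    simp only [hwest, hij]
  · intro i j hij
    have hij : s i 1 1 = s j 1 1 := hij
    simp only [hsouth, hij]

/-- Above a yellow color with a single tile type, a green run that is longer than the number of
its tile types is periodic, so some tile of the run has the west glue of the Up-Arrow tile. -/
theorem exists_green_of_greenRun (hU : Uniqueness T) {n : ℕ} {g ua y : Color}
    {s : ℕ → ℕ → TileType Glue} (hs : Realizes T (greenRun n g y ua) s)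
    (hy : colorCount T y ≤ 1) (hn : colorCount T g < n) :
    ∃ k, 1 ≤ k ∧ k ≤ n ∧ (s k 2).west = (s (n + 1) 2).west := by
  have hdet : ∀ p q, 1 ≤ p → p < n → 1 ≤ q → q < n → s p 2 = s q 2 →
      s (p + 1) 2 = s (q + 1) 2 := by
    intro p q hp hpn hq hqn hpq
    refine hU _ (Finset.mem_filter.1 (hs.mem (greenRun_upper (by omega) (by omega)))).1
      _ (Finset.mem_filter.1 (hs.mem (greenRun_upper (by omega) (by omega)))).1 ?_ ?_
    · rw [hs.vertical (greenRun_lower (k := p + 1) (by omega) (by omega))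
          (greenRun_upper (by omega) (by omega)),
        hs.vertical (greenRun_lower (k := q + 1) (by omega) (by omega))
          (greenRun_upper (by omega) (by omega)),
        hs.eq_of_colorCount_le_one hs hy (greenRun_lower (k := p + 1) (by omega) (by omega))
          (greenRun_lower (k := q + 1) (by omega) (by omega))]
    · rw [hs.horizontal (greenRun_upper (k := p) (by omega) (by omega))
          (greenRun_upper (by omega) (by omega)),
        hs.horizontal (greenRun_upper (k := q) (by omega) (by omega))
          (greenRun_upper (by omega) (by omega)), hpq]
  have hrep : ∃ p q, 1 ≤ p ∧ p < q ∧ q ≤ n ∧ s p 2 = s q 2 := by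
    obtain ⟨p, hp, q, hq, hpq, heq⟩ := Finset.exists_ne_map_eq_of_card_lt_of_maps_to
      (s := Finset.Icc 1 n) (t := T.filter (fun t => t.color = g)) (f := fun k => s k 2)
      (by simpa [colorCount] using hn) (by
        intro k hk
        have hk := Finset.mem_Icc.1 (Finset.mem_coe.1 hk)
        exact hs.mem (greenRun_upper hk.1 hk.2))
    rw [Finset.mem_Icc] at hp hq
    rcases lt_or_gt_of_ne hpq with h | h
    · exact ⟨p, q, hp.1, h, hq.2, heq⟩
    · exact ⟨q, p, hq.1, h, hp.2, heq.symm⟩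
  obtain ⟨p, q, hp, hpq, hq, heq⟩ := hrep
  have hk : ∀ k, q + k ≤ n → s (p + k) 2 = s (q + k) 2 := by
    intro k
    induction k with
    | zero => intro _; exact heq
    | succ k ih =>
      intro hle
      exact hdet (p + k) (q + k) (by omega) (by omega) (by omega) (by omega) (ih (by omega))
  have hlast := hk (n - q) (by omega)
  rw [show q + (n - q) = n by omega] at hlast
  -- The tile at `p + (n - q)` equals the last green tile, and its right neighbor is still green as
  -- `p < q`. That neighbor and the Up-Arrow tile receive the same east glue.
  refine ⟨p + (n - q) + 1, by omega, by omega, ?_⟩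
  rw [hs.horizontal (greenRun_upper (k := p + (n - q)) (by omega) (by omega))
      (greenRun_upper (by omega) (by omega)), hlast,
    hs.horizontal (greenRun_upper (k := n) (by omega) (by omega)) greenRun_last]

/-- Every Up-Arrow tile type that is missing costs a full run of tile types of a green color. -/
theorem four_le_colorCount_add_card (hU : Uniqueness T) {n : ℕ} {ua y : Color}
    (h : ∀ i, ∃ s, Realizes T (greenRun n (.green i) y ua) s) (hy : colorCount T y ≤ 1) :
    4 ≤ colorCount T ua +
      (Finset.univ.filter (fun i : Fin 4 => n ≤ colorCount T (.green i))).card := by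
  choose s hs using h
  -- For green colors with fewer than `n` types, the Up-Arrow tile determines the color: a green
  -- tile with its west glue lies above the only yellow type.
  have hle : (Finset.univ.filter (fun i : Fin 4 => ¬ n ≤ colorCount T (.green i))).card ≤
      colorCount T ua := by
    refine Finset.card_le_card_of_injOn (fun i => s i (n + 1) 2)
      (fun i _ => (hs i).mem greenRun_last) ?_
    intro i hi j hj hij
    have hij : s i (n + 1) 2 = s j (n + 1) 2 := hij
    have hi : colorCount T (.green i) < n := by simpa using hi
    have hj : colorCount T (.green j) < n := by simpa using hj
    obtain ⟨k, hk1, hkn, hk⟩ := exists_green_of_greenRun hU (hs i) hy hi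
    obtain ⟨l, hl1, hln, hl⟩ := exists_green_of_greenRun hU (hs j) hy hj
    have hik := Finset.mem_filter.1 ((hs i).mem (greenRun_upper hk1 hkn))
    have hjl := Finset.mem_filter.1 ((hs j).mem (greenRun_upper hl1 hln))
    have heq : s i k 2 = s j l 2 := by
      refine hU _ hik.1 _ hjl.1 ?_ (by rw [hk, hl, hij])
      rw [(hs i).vertical (greenRun_lower hk1 hkn) (greenRun_upper hk1 hkn),
        (hs j).vertical (greenRun_lower hl1 hln) (greenRun_upper hl1 hln),
        (hs i).eq_of_colorCount_le_one (hs j) hy (greenRun_lower hk1 hkn)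
          (greenRun_lower hl1 hln)]
    exact Color.green.inj (by rw [← hik.2, ← hjl.2, heq])
  have hadd := Finset.card_filter_add_card_filter_not (s := (Finset.univ : Finset (Fin 4)))
    (fun i => n ≤ colorCount T (.green i))
  simp only [Finset.card_univ, Fintype.card_fin] at hadd
  omega

theorem four_add_mul_card_le_sum {f : Fin 4 → ℕ} (hf : ∀ i, 1 ≤ f i) (n : ℕ) :
    4 + n * (Finset.univ.filter (fun i : Fin 4 => n + 1 ≤ f i)).card ≤ ∑ i, f i := by
  have h : ∑ i : Fin 4, (1 + if n + 1 ≤ f i then n else 0) ≤ ∑ i, f i := by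
    refine Finset.sum_le_sum fun i _ => ?_
    have := hf i
    split_ifs <;> omega
  rw [Finset.sum_add_distrib, ← Finset.sum_filter] at h
  simpa [mul_comm] using h

/-! ### Tiles to the right of an Up-Arrow tile -/

/-- One type each for `ua` and `below` would fix both input glues of the corner tile, and thus its
color. -/
theorem two_lt_add_of_topCorner (hU : Uniqueness T) {ua below out out' : Color}
    {s s' : ℕ → ℕ → TileType Glue} (hs : Realizes T (topCorner ua below out) s)
    (hs' : Realizes T (topCorner ua below out') s') (hne : out ≠ out') :
    2 < colorCount T ua + colorCount T below := by
  have c1 : ∀ o, topCorner ua below o 1 2 = some ua := fun o => by simp [topCorner]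
  have c2 : ∀ o, topCorner ua below o 2 2 = some o := fun o => by simp [topCorner]
  have c3 : ∀ o, topCorner ua below o 2 1 = some below := fun o => by simp [topCorner]
  have p1 := colorCount_pos hs (c1 _)
  have p3 := colorCount_pos hs (c3 _)
  by_contra hlt
  have m := Finset.mem_filter.1 (hs.mem (c2 _))
  have m' := Finset.mem_filter.1 (hs'.mem (c2 _))
  have heq : s 2 2 = s' 2 2 := by
    refine hU _ m.1 _ m'.1 ?_ ?_
    · rw [hs.vertical (c3 _) (c2 _), hs'.vertical (c3 _) (c2 _),
        hs.eq_of_colorCount_le_one hs' (by omega) (c3 _) (c3 _)]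
    · rw [hs.horizontal (c1 _) (c2 _), hs'.horizontal (c1 _) (c2 _),
        hs.eq_of_colorCount_le_one hs' (by omega) (c1 _) (c1 _)]
  exact hne (by rw [← m.2, ← m'.2, heq])

/-! ### The lower bound -/

theorem lowerBound_le_colorCount (hP : ContainsLB P) (hT : Solves T P) (hcard : T.card ≤ 46)
    (c : Color) : lowerBound c ≤ colorCount T c := by
  obtain ⟨σ, hσ⟩ := hT
  have hU := hσ.1
  obtain ⟨s1, hs1⟩ := hσ.exists_realizes hP.lb1
  have hel : ∀ i c, i = 2 ∧ c = Color.elBlack ∨ i = 4 ∧ c = Color.elWhite ∨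
      i = 6 ∧ c = Color.carryBlue → colorCount T c ≤ 1 → 19 ≤ colorCount T .black := by
    intro i c hic hc
    refine nineteen_le_colorCount_black hU hs1 (i := i) hc ?_ ?_ <;> intro j hj hj' <;>
      obtain ⟨rfl, rfl⟩ | ⟨rfl, rfl⟩ | ⟨rfl, rfl⟩ := hic <;> simp [lb1, hj, hj'] <;>
      split_ifs <;> rfl
  have hel1 := hel 2 .elBlack (by simp)
  have hel2 := hel 4 .elWhite (by simp)
  have hcb := hel 6 .carryBlue (by simp)
  -- The second alternative costs four extra types, one per copy, while it saves at most two Carry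
  -- Blue types, since `hcb` already excludes a single one.
  have hblue : 4 ≤ colorCount T .carryBlue ∨
      ∀ i, 3 ≤ colorCount T (.blackCopy i) + colorCount T (.whiteCopy i) := by
    by_contra! hno
    obtain ⟨hlt, i, hi⟩ := hno
    obtain ⟨s, hs⟩ := hσ.exists_realizes (hP.lb43_to_lb46 i)
    have pb := colorCount_pos hs (i := 1) (j := 1) (c := .blackCopy i) (by simp [PATS.lb42])
    have pw := colorCount_pos hs (i := 1) (j := 3) (c := .whiteCopy i) (by simp [PATS.lb42])
    have := four_le_colorCount_carryBlue hU (by simp) hs (by omega) (by omega)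
    omega
  have hRAB : ∀ y, IsYellow y → 4 ≤ colorCount T .rab * colorCount T y := fun y hy =>
    four_le_mul_of_greenCorner hU fun i => hσ.exists_realizes (hP.lb6_to_lb23 i y hy)
  have hRAW : ∀ y, IsYellow y → 4 ≤ colorCount T .raw * colorCount T y := fun y hy =>
    four_le_mul_of_greenCorner hU fun i => hσ.exists_realizes (hP.lb24_to_lb41 i y hy)
  have hrunB : ∀ y, IsYellow y → ∀ i, ∃ s, Realizes T (greenRun 6 (.green i) y .uab) s :=
    fun y hy i => hσ.exists_realizes (hP.lb47_to_lb82 i y hy)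
  have hrunW : ∀ y, IsYellow y → ∀ i, ∃ s, Realizes T (greenRun 4 (.green i) y .uaw) s :=
    fun y hy i => hσ.exists_realizes (hP.lb83_to_lb118 i y hy)
  have hwhite : 2 < colorCount T .uaw + colorCount T .white := by
    obtain ⟨s, hs⟩ := hσ.exists_realizes hP.lb4
    obtain ⟨s', hs'⟩ := hσ.exists_realizes hP.lb5
    exact two_lt_add_of_topCorner hU hs hs' (by simp)
  have hblack : IsYellow .black := Or.inl rfl
  have hpos : ∀ c, 1 ≤ colorCount T c := by
    obtain ⟨sB, hsB⟩ := hrunB .black hblack 0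
    obtain ⟨sW, hsW⟩ := hrunW .black hblack 0
    rintro (_ | _ | _ | _ | _ | _ | _ | _ | _ | i | i | k | i)
    · exact colorCount_pos hs1 (i := 1) (j := 1) (by simp [PATS.lb1])
    · exact colorCount_pos hs1 (i := 1) (j := 20) (by simp [PATS.lb1])
    · exact colorCount_pos hs1 (i := 2) (j := 1) (by simp [PATS.lb1])
    · exact colorCount_pos hs1 (i := 4) (j := 1) (by simp [PATS.lb1])
    · exact colorCount_pos hs1 (i := 6) (j := 1) (by simp [PATS.lb1])
    · exact Nat.pos_of_mul_pos_right (lt_of_lt_of_le (by norm_num) (hRAB _ hblack))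
    · exact Nat.pos_of_mul_pos_right (lt_of_lt_of_le (by norm_num) (hRAW _ hblack))
    · exact colorCount_pos hsB greenRun_last
    · exact colorCount_pos hsW greenRun_last
    · obtain ⟨s, hs⟩ := hσ.exists_realizes (hP.lb43_to_lb46 i)
      exact colorCount_pos hs (i := 1) (j := 1) (by simp [PATS.lb42])
    · obtain ⟨s, hs⟩ := hσ.exists_realizes (hP.lb43_to_lb46 i)
      exact colorCount_pos hs (i := 1) (j := 3) (by simp [PATS.lb42])
    · obtain ⟨s, hs⟩ := hrunB (.purple k) (Or.inr ⟨k, rfl⟩) 0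
      exact colorCount_pos hs (greenRun_lower (le_refl 1) (by norm_num))
    · obtain ⟨s, hs⟩ := hrunB .black hblack i
      exact colorCount_pos hs (greenRun_upper (le_refl 1) (by norm_num))
  have hsum := card_eq_sum_colorCount T
  have sum_le : ∀ (m N : ℕ) (f : Fin N → ℕ), (∀ i, m ≤ f i) → N * m ≤ ∑ i, f i := by
    intro m N f hf
    simpa using Finset.card_nsmul_le_sum Finset.univ f m (fun i _ => hf i)
  have copies := sum_le 1 4 _ (fun i => hpos (.blackCopy i))
  have copies' := sum_le 1 4 _ (fun i => hpos (.whiteCopy i))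
  have purples := sum_le 1 8 _ (fun k => hpos (.purple k))
  have greens := sum_le 1 4 _ (fun i => hpos (.green i))
  have hblue' : 4 ≤ colorCount T .carryBlue ∨
      12 ≤ ∑ i, colorCount T (.blackCopy i) + ∑ i, colorCount T (.whiteCopy i) := by
    refine hblue.imp_right fun h => ?_
    rw [← Finset.sum_add_distrib]
    exact sum_le 3 4 _ h
  have p1 := hpos .black
  have p2 := hpos .white
  have p3 := hpos .elBlack
  have p4 := hpos .elWhite
  have p5 := hpos .carryBlue
  have p6 := hpos .rab
  have p7 := hpos .raw
  have p8 := hpos .uab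
  have p9 := hpos .uaw
  -- Otherwise nine types are added to the 29 for the yellows, two for el-Black and el-White, at
  -- least three for Carry Blue or the copies, one for each Right-Arrow, one for UAB or the greens,
  -- and one for UAW or White: 47 in all.
  have hyellow : ∃ y, IsYellow y ∧ colorCount T y ≤ 1 := by
    by_contra! hall
    have y0 := hall _ hblack
    have purples2 := sum_le 2 8 _ (fun k => hall (.purple k) (Or.inr ⟨k, rfl⟩))
    have four : ∀ x, (∀ y, IsYellow y → 4 ≤ x * colorCount T y) → x ≤ 1 →
        4 ≤ colorCount T .black ∧ 32 ≤ ∑ k, colorCount T (.purple k) := by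
      intro x hx hx1
      have h : ∀ y, IsYellow y → 4 ≤ colorCount T y := fun y hy =>
        (hx y hy).trans (by simpa using Nat.mul_le_mul_right (colorCount T y) hx1)
      exact ⟨h _ hblack, sum_le 4 8 _ fun k => h (.purple k) (Or.inr ⟨k, rfl⟩)⟩
    have f1 := four _ hRAB
    have f2 := four _ hRAW
    have f3 : colorCount T .uab ≤ 1 → 5 ≤ ∑ i, colorCount T (.green i) ∨
        32 ≤ ∑ k, colorCount T (.purple k) := by
      intro hu
      by_cases hone : ∀ i, colorCount T (.green i) ≤ 1
      · exact Or.inr (four _ (fun y hy =>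
          four_le_mul_of_greenRun hU (by norm_num) (hrunB y hy) hone) hu).2
      · push Not at hone
        obtain ⟨i, hi⟩ := hone
        left
        have := Finset.sum_lt_sum (s := Finset.univ) (f := fun _ : Fin 4 => 1)
          (fun i _ => hpos (.green i)) ⟨i, Finset.mem_univ i, hi⟩
        simpa [Nat.lt_iff_add_one_le] using this
    omega
  obtain ⟨y, hy, hy1⟩ := hyellow
  have eqy : colorCount T y = 1 := le_antisymm hy1 (hpos y)
  have g1 := hRAB y hy
  have g2 := hRAW y hy
  rw [eqy, mul_one] at g1 g2
  have uB := four_le_colorCount_add_card hU (hrunB y hy) hy1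
  have uW := four_le_colorCount_add_card hU (hrunW y hy) hy1
  have gB := four_add_mul_card_le_sum (fun i => hpos (.green i)) 5
  have gW := four_add_mul_card_le_sum (fun i => hpos (.green i)) 3
  norm_num at gB gW
  have p := hpos c
  -- If `k` UAB and `m` UAW types are missing, the greens have at least max(5k, 3m) extra types,
  -- which exceeds k + m unless both vanish. One long green run may serve both arrows, hence the
  -- maximum and not the sum.
  cases c <;> simp only [lowerBound] <;> omega

theorem sum_lowerBound_le (h : ∀ c, lowerBound c ≤ colorCount T c) : 46 ≤ T.card := by
  rw [card_eq_sum_colorCount T]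
  have sums : ∀ (N : ℕ) (f : Fin N → Color), (∀ i, 1 ≤ lowerBound (f i)) →
      N ≤ ∑ i, colorCount T (f i) := by
    intro N f hf
    simpa using Finset.card_nsmul_le_sum Finset.univ (fun i => colorCount T (f i)) 1
      (fun i _ => (hf i).trans (h _))
  have s1 := sums 4 .blackCopy (by simp [lowerBound])
  have s2 := sums 4 .whiteCopy (by simp [lowerBound])
  have s3 := sums 8 .purple (by simp [lowerBound])
  have s4 := sums 4 .green (by simp [lowerBound])
  have h1 := h .black
  have h2 := h .white
  have h3 := h .elBlack
  have h4 := h .elWhite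
  have h5 := h .carryBlue
  have h6 := h .rab
  have h7 := h .raw
  have h8 := h .uab
  have h9 := h .uaw
  simp only [lowerBound] at h1 h2 h3 h4 h5 h6 h7 h8 h9
  omega

end PATS

theorem mainTheorem5 {Glue : Type*} (P : PATS.ColorPattern) (hP : PATS.ContainsLB P)
    (T : Finset (PATS.TileType Glue)) (hT : PATS.Solves T P) :
    46 ≤ T.card ∧
      (T.card ≤ 46 → ∀ c : PATS.Color,
        PATS.lowerBound c ≤ (T.filter (fun t => t.color = c)).card) := by
  refine ⟨?_, fun h c => PATS.lowerBound_le_colorCount hP hT h c⟩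
  -- Fewer than 46 types would satisfy the hypothesis of the color bounds, whose sum is 46.
  by_contra hlt
  exact hlt (PATS.sum_lowerBound_le (PATS.lowerBound_le_colorCount hP hT (by omega)))
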